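/- Let $\lambda=(\lambda_1\ge\lambda_2\ge\cdots\ge\lambda_\ell)$ be a partition of a positive integer. Its rank is $\lambda_1-\ell$, the largest part minus the number of parts. Its (Dyson) rank-set is the set of integers $$\{\,j-\lambda_{j+1} : 0\le j\le \ell-1\,\}\cup\{\ell,\ell+1,\ell+2,\ldots\}.$$ For integers $m\ge 0$ and $n\ge 1$, let $q(m,n)$ be the number of partitions of $n$ whose rank-set contains $m$, and let $p(-m,n)$ be the number of partitions of $n$ whose rank is at least $-m$. Then for all integers $m\geq 0$ and $n\geq 1$, $$q(m,n)\le p(-m,n).$$ -/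

import Mathlib

namespace DysonRank

/-- The `i`-th part of a partition, counted from `i = 0` and in weakly decreasing order, so that
`part μ 0` is the largest part; it is `0` once the parts are exhausted. -/
def part {n : ℕ} (μ : n.Partition) (i : ℕ) : ℕ :=
  (μ.parts.sort (fun a b => b ≤ a)).getD i 0

/-- The number of parts of a partition. -/
def length {n : ℕ} (μ : n.Partition) : ℕ := μ.parts.card

/-- Dyson's rank: the largest part minus the number of parts. -/
def rank {n : ℕ} (μ : n.Partition) : ℤ := (part μ 0 : ℤ) - (length μ : ℤ)

/-- Dyson's rank-set of `μ = (μ₁ ≥ μ₂ ≥ ⋯ ≥ μ_ℓ)`: the integers `j - μ_{j+1}` for `0 ≤ j < ℓ`,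
together with all the integers `j ≥ ℓ`. -/
def rankSet {n : ℕ} (μ : n.Partition) : Set ℤ :=
  {r | ∃ j : ℕ, j < length μ ∧ r = (j : ℤ) - (part μ j : ℤ)} ∪
    {r | ∃ j : ℕ, length μ ≤ j ∧ r = (j : ℤ)}

/-- `q m n` is the number of partitions of `n` whose rank-set contains `m`. -/
noncomputable def q (m : ℤ) (n : ℕ) : ℕ := {μ : n.Partition | m ∈ rankSet μ}.ncard

/-- `p r n` is the number of partitions of `n` whose rank is at least `r`. -/
noncomputable def p (r : ℤ) (n : ℕ) : ℕ := {μ : n.Partition | r ≤ rank μ}.ncard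

end DysonRank

/-!
The partitions counted on both sides cancel, so the claim is that the partitions of `n` with `m` in
the rank-set and rank below `-m` are at most as many as those with `m` outside the rank-set and rank
at least `-m` (`ncard_rankSet_diff_le`).

The rank-set, reflected and shifted, is the bead set of the partition: with `K = c + m + 1` rows and
`c` large, the partitions of `n` correspond to the `K`-element sets `S ⊆ ℕ` of sum
`n + (0 + 1 + ⋯ + (K - 1))` (`beads_injective`, `exists_beads_eq`), and `m` lies in the rank-set
exactly when `c ∈ S`. Recording the gaps of `S` below `c` and the beads above `c` by their distances
to `c`, one gets a pair of finite sets of positive integers. The first family of partitions becomes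
the set of pairs `(A, B)` with `|B| = |A| + m` and `max B ≤ max A + m`, where `A` holds the gaps; the
second becomes the set of pairs with `|A| = |B| + m + 1` and `max B + m + 1 ≤ max A`, where `B` holds
the gaps. In both cases the elements of `A` and `B` add up to `N = n + (0 + 1 + ⋯ + m)`.

The injection between these pairs is a reflection argument. Given `(A, B)`, let `k ≥ 1` be least such
that `k ∈ B` or `max A - k ∉ A`. Thus `A` ends in a block of `k` consecutive integers, and `B` has no
element below `k`. Strip the block from `A`, strip `k` from `B` if it is there, and lower what is
left of `B` by `k`. In the remaining pair, `B` has at least `k - 1` more elements than `A` among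
the integers up to the stripped block, so that there is a least `p` up to which `B` has exactly
`k - 1` more elements than `A`. Exchange the parts of `A` and `B` above `p` (`IsSource.swapTails`):
this changes no element, does not move `p`, hence can be undone, and changes the difference of the
cardinalities as required. Finally raise `B` by `k`, put a block of `k` consecutive integers on top
of `A`, and insert `k` into `B` exactly if it was *not* there before. The loss from the smaller
cardinality of `B` pays for the higher position of the block. The result determines `k` and all the
other data (`targetPair_injOn`), by the same description as before.
-/

namespace DysonRank

/-! ### Partitions as antitone sequences -/

theorem part_antitone {n : ℕ} (μ : n.Partition) : Antitone (part μ) := by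
  intro i j hij
  unfold part
  set l := μ.parts.sort (fun a b => b ≤ a) with hl
  have hs : l.Pairwise (fun a b => b ≤ a) := Multiset.pairwise_sort _ _
  rcases lt_or_ge j l.length with hj | hj
  · rw [List.getD_eq_getElem _ _ hj, List.getD_eq_getElem _ _ (hij.trans_lt hj)]
    rcases hij.eq_or_lt with rfl | h
    · exact le_rfl
    · exact List.pairwise_iff_getElem.1 hs i j _ _ h
  · rw [List.getD_eq_default _ _ hj]
    exact Nat.zero_le _

theorem part_eq_zero_iff {n : ℕ} (μ : n.Partition) (j : ℕ) : part μ j = 0 ↔ length μ ≤ j := by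
  unfold part length
  set l := μ.parts.sort (fun a b => b ≤ a) with hl
  have hlen : l.length = μ.parts.card := Multiset.length_sort _
  rw [← hlen]
  rcases lt_or_ge j l.length with hj | hj
  · rw [List.getD_eq_getElem _ _ hj]
    have : 0 < l[j] := μ.parts_pos ((Multiset.mem_sort (r := fun a b => b ≤ a)).1 (List.getElem_mem hj))
    omega
  · rw [List.getD_eq_default _ _ hj]
    simp [hj]

theorem map_part_range {n : ℕ} (μ : n.Partition) :
    (Multiset.range (length μ)).map (part μ) = μ.parts := by
  unfold part length
  set l := μ.parts.sort (fun a b => b ≤ a) with hl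
  have hlen : l.length = μ.parts.card := Multiset.length_sort _
  rw [← hlen]
  have h2 : (l : Multiset ℕ) = μ.parts := Multiset.sort_eq _ _
  rw [← h2]
  change ((List.range l.length).map fun i => l.getD i 0 : Multiset ℕ) = l
  congr 1
  apply List.ext_getElem
  · simp
  · intro i h1 h2
    simp [h2]

theorem partition_ext {n : ℕ} {μ ν : n.Partition} (h : part μ = part ν) : μ = ν := by
  have hlen : length μ = length ν := by
    apply le_antisymm
    · rw [← part_eq_zero_iff, h, part_eq_zero_iff]
    · rw [← part_eq_zero_iff, ← h, part_eq_zero_iff]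
  apply Nat.Partition.ext
  rw [← map_part_range μ, ← map_part_range ν, h, hlen]

theorem length_le {n : ℕ} (μ : n.Partition) : length μ ≤ n := by
  have h := Multiset.card_nsmul_le_sum (s := μ.parts) (a := 1) fun x hx => μ.parts_pos hx
  rw [μ.parts_sum] at h
  simpa [length] using h

theorem sum_part {n : ℕ} (μ : n.Partition) {K : ℕ} (hK : length μ ≤ K) :
    ∑ j ∈ Finset.range K, part μ j = n := by
  have h1 : ∑ j ∈ Finset.range (length μ), part μ j = n := by
    have := congrArg Multiset.sum (map_part_range μ)
    rw [μ.parts_sum] at this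
    exact this
  refine Eq.trans (Finset.sum_subset (Finset.range_mono hK) fun x _ hx => ?_).symm h1
  rw [part_eq_zero_iff]
  simpa using hx

/-- An antitone sequence with finitely many nonzero terms is the sequence of parts of a partition of
its sum. -/
theorem exists_part_eq {n K : ℕ} {f : ℕ → ℕ} (hf : Antitone f) (h0 : ∀ j, K ≤ j → f j = 0)
    (hsum : ∑ j ∈ Finset.range K, f j = n) : ∃ μ : n.Partition, part μ = f := by
  have hex : ∃ j, f j = 0 := ⟨K, h0 K le_rfl⟩
  set l := Nat.find hex with hl
  have hl0 : ∀ j, l ≤ j → f j = 0 := fun j hj =>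
    Nat.le_zero.1 ((hf hj).trans (Nat.find_spec hex).le)
  have hlp : ∀ j, j < l → 0 < f j := fun j hj => Nat.pos_of_ne_zero (Nat.find_min hex hj)
  have hlK : l ≤ K := Nat.find_le (h0 K le_rfl)
  have hs : ((Multiset.range l).map f).sum = n := by
    rw [← hsum]
    apply Finset.sum_subset (Finset.range_mono hlK)
    intro x _ hx
    exact hl0 x (by simpa using hx)
  refine ⟨⟨(Multiset.range l).map f, ?_, hs⟩, ?_⟩
  · intro i hi
    obtain ⟨j, hj, rfl⟩ := Multiset.mem_map.1 hi
    exact hlp j (Multiset.mem_range.1 hj)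
  · have hsort : ((Multiset.range l).map f).sort (fun a b => b ≤ a) = (List.range l).map f := by
      apply List.Perm.eq_of_pairwise (le := fun a b => b ≤ a)
      · intro a b _ _ h1 h2
        exact le_antisymm h2 h1
      · exact Multiset.pairwise_sort _ _
      · rw [List.pairwise_map]
        exact List.pairwise_lt_range.imp fun h => hf h.le
      · rw [← Multiset.coe_eq_coe, Multiset.sort_eq]
        rfl
    funext j
    simp only [part, hsort]
    rcases lt_or_ge j l with hj | hj
    · rw [List.getD_eq_getElem _ _ (by simpa using hj)]
      simp
    · rw [List.getD_eq_default _ _ (by simpa using hj), hl0 j hj]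

/-! ### Bead sets -/

/-- The bead set of `μ` with `K` beads, namely the numbers `part μ j + (K - 1 - j)` for `j < K`: the
first-column hook lengths after padding `μ` with zero parts to `K` rows. The index `j` is replaced by
`i = K - 1 - j`, so that the elements are listed in increasing order. It is meant for
`length μ ≤ K`. -/
def beads {n : ℕ} (K : ℕ) (μ : n.Partition) : Finset ℕ :=
  (Finset.range K).image fun i => part μ (K - 1 - i) + i

theorem strictMono_beads {n : ℕ} (K : ℕ) (μ : n.Partition) :
    StrictMono fun i : ℕ => part μ (K - 1 - i) + i := by
  intro i j hij
  have : part μ (K - 1 - i) ≤ part μ (K - 1 - j) := part_antitone μ (by omega)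
  dsimp only
  omega

theorem mem_beads {n K : ℕ} {μ : n.Partition} {y : ℕ} :
    y ∈ beads K μ ↔ ∃ j < K, y = part μ j + (K - 1 - j) := by
  simp only [beads, Finset.mem_image, Finset.mem_range]
  constructor
  · rintro ⟨i, hi, rfl⟩
    exact ⟨K - 1 - i, by omega, by omega⟩
  · rintro ⟨j, hj, rfl⟩
    refine ⟨K - 1 - j, by omega, ?_⟩
    rw [show K - 1 - (K - 1 - j) = j by omega]

theorem card_beads {n : ℕ} (K : ℕ) (μ : n.Partition) : (beads K μ).card = K := by
  rw [beads, Finset.card_image_of_injective _ (strictMono_beads K μ).injective, Finset.card_range]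

theorem sum_beads {n K : ℕ} (μ : n.Partition) (hK : n ≤ K) :
    ∑ y ∈ beads K μ, y = n + ∑ i ∈ Finset.range K, i := by
  rw [beads, Finset.sum_image (strictMono_beads K μ).injective.injOn, Finset.sum_add_distrib,
    Finset.sum_range_reflect (part μ) K, sum_part μ ((length_le μ).trans hK)]

theorem beads_injective {n K : ℕ} (hK : n ≤ K) :
    Function.Injective (beads K : n.Partition → Finset ℕ) := by
  intro μ ν h
  have key : ∀ ξ : n.Partition, beads K ξ = beads K μ →
      (fun i : Fin K => part ξ (K - 1 - i) + i) = (beads K μ).orderEmbOfFin (card_beads K μ) := by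
    intro ξ hξ
    apply Finset.orderEmbOfFin_unique
    · intro i
      rw [← hξ]
      exact Finset.mem_image.2 ⟨i, Finset.mem_range.2 i.2, rfl⟩
    · intro i j hij
      exact strictMono_beads K ξ hij
  have h2 := (key μ rfl).trans (key ν h.symm).symm
  apply partition_ext
  funext j
  rcases lt_or_ge j K with hj | hj
  · have := congrFun h2 ⟨K - 1 - j, by omega⟩
    simp only [show K - 1 - (K - 1 - j) = j by omega] at this
    omega
  · rw [(part_eq_zero_iff μ j).2 ((length_le μ).trans (hK.trans hj)),
      (part_eq_zero_iff ν j).2 ((length_le ν).trans (hK.trans hj))]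

/-- Every set of `K` naturals with the right sum is a bead set: subtract `0, 1, …, K - 1` from its
elements in increasing order to get the parts. -/
theorem exists_beads_eq {n K : ℕ} {S : Finset ℕ} (hc : S.card = K)
    (hs : ∑ y ∈ S, y = n + ∑ i ∈ Finset.range K, i) : ∃ μ : n.Partition, beads K μ = S := by
  let g := S.orderEmbOfFin hc
  have hg : ∀ i : Fin K, (i : ℕ) ≤ g i := by
    rintro ⟨i, hi⟩
    induction i with
    | zero => exact Nat.zero_le _
    | succ i ih =>
      have h1 := ih (by omega)
      have h2 : g ⟨i, by omega⟩ < g ⟨i + 1, hi⟩ := g.strictMono (by simp [Fin.lt_def])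
      simp only at h1 ⊢
      omega
  let f : ℕ → ℕ := fun j => if h : j < K then g ⟨K - 1 - j, by omega⟩ - (K - 1 - j) else 0
  have hstep : ∀ i (h : i + 1 < K), g ⟨i, by omega⟩ + 1 ≤ g ⟨i + 1, h⟩ := fun i h =>
    g.strictMono (by simp [Fin.lt_def])
  have hf : Antitone f := by
    apply antitone_nat_of_succ_le
    intro j
    simp only [f]
    split_ifs with h1 h2
    · have h3 := hstep (K - 1 - (j + 1)) (by omega)
      simp only [show K - 1 - (j + 1) + 1 = K - 1 - j by omega] at h3
      omega
    · omega
    · omega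
    · omega
  have hgf : ∀ i : Fin K, f (K - 1 - i) + i = g i := by
    intro i
    have h1 : K - 1 - i < K := by omega
    have h2 := hg i
    simp only [f, h1, dif_pos, show K - 1 - (K - 1 - (i : ℕ)) = i by omega, Fin.eta]
    omega
  have himg : (Finset.range K).image (fun i => f (K - 1 - i) + i) = S := by
    ext y
    simp only [Finset.mem_image, Finset.mem_range]
    constructor
    · rintro ⟨i, hi, rfl⟩
      rw [hgf ⟨i, hi⟩]
      exact Finset.orderEmbOfFin_mem _ _ _
    · intro hy
      have : y ∈ Set.range g := by
        rw [Finset.range_orderEmbOfFin]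
        exact hy
      obtain ⟨i, rfl⟩ := this
      exact ⟨i, i.2, hgf i⟩
  have hinj : Set.InjOn (fun i => f (K - 1 - i) + i) (Finset.range K : Set ℕ) := by
    rw [← Finset.card_image_iff, himg, hc, Finset.card_range]
  have hsum : ∑ j ∈ Finset.range K, f j = n := by
    rw [← himg, Finset.sum_image hinj, Finset.sum_add_distrib, Finset.sum_range_reflect f K] at hs
    omega
  obtain ⟨μ, hμ⟩ := exists_part_eq hf (fun j hj => by simp [f, Nat.not_lt.2 hj]) hsum
  exact ⟨μ, by rw [beads, hμ, himg]⟩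

/-- With `c + m + 1` beads, the integer `r` of the rank-set corresponds to the bead `c + m - r`. -/
theorem mem_rankSet_iff {n c m : ℕ} (μ : n.Partition) (hc : n ≤ c) :
    (m : ℤ) ∈ rankSet μ ↔ c ∈ beads (c + m + 1) μ := by
  rw [mem_beads]
  simp only [rankSet, Set.mem_union, Set.mem_ofPred_eq]
  constructor
  · rintro (⟨j, hj, h⟩ | ⟨j, hj, h⟩)
    · have := length_le μ
      exact ⟨j, by omega, by omega⟩
    · obtain rfl : m = j := by exact_mod_cast h
      exact ⟨m, by omega, by rw [(part_eq_zero_iff μ m).2 hj]; omega⟩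
  · rintro ⟨j, hj, h⟩
    rcases lt_or_ge j (length μ) with h1 | h1
    · exact Or.inl ⟨j, h1, by omega⟩
    · rw [(part_eq_zero_iff μ j).2 h1] at h
      exact Or.inr ⟨m, by omega, rfl⟩

/-- The largest bead is the largest part plus `K - 1` and the least non-bead is `K - length μ`, where
`K = c + m + 1`, so their sum measures the rank. -/
theorem rank_lt_neg_iff {n c m : ℕ} (μ : n.Partition) (hc : n ≤ c) :
    rank μ < -(m : ℤ) ↔
      ∃ z, z ∉ beads (c + m + 1) μ ∧ ∀ y ∈ beads (c + m + 1) μ, y + z < 2 * c + m + 1 := by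
  have hl := (length_le μ).trans hc
  have hz : c + m + 1 - length μ ∉ beads (c + m + 1) μ := by
    rw [mem_beads]
    rintro ⟨j, hj, h⟩
    have := part_eq_zero_iff μ j
    omega
  have hlow : ∀ z < c + m + 1 - length μ, z ∈ beads (c + m + 1) μ := by
    intro z hz
    rw [mem_beads]
    have := part_eq_zero_iff μ (c + m - z)
    exact ⟨c + m - z, by omega, by omega⟩
  have hr : rank μ < -(m : ℤ) ↔ part μ 0 + m < length μ := by
    unfold rank
    omega
  rw [hr]
  constructor
  · intro h
    refine ⟨_, hz, fun y hy => ?_⟩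
    obtain ⟨j, hj, rfl⟩ := mem_beads.1 hy
    have : part μ j ≤ part μ 0 := part_antitone μ (Nat.zero_le j)
    omega
  · rintro ⟨z, hz1, hz2⟩
    have h1 : c + m + 1 - length μ ≤ z := not_lt.1 fun h => hz1 (hlow z h)
    have := hz2 _ (mem_beads.2 ⟨0, by omega, rfl⟩)
    omega

/-! ### Pairs of finite sets attached to a bead set -/

/-- The distances from `c` down to the numbers missing from `S` below `c`. -/
def lower (c : ℕ) (S : Finset ℕ) : Finset ℕ := (Finset.Icc 1 c).filter fun a => c - a ∉ S

/-- The distances from `c` up to the elements of `S` above `c`. -/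
def upper (c : ℕ) (S : Finset ℕ) : Finset ℕ := (S.filter (c < ·)).image (· - c)

theorem mem_lower {c a : ℕ} {S : Finset ℕ} : a ∈ lower c S ↔ (1 ≤ a ∧ a ≤ c) ∧ c - a ∉ S := by
  simp [lower]

theorem mem_upper {c b : ℕ} {S : Finset ℕ} : b ∈ upper c S ↔ 1 ≤ b ∧ c + b ∈ S := by
  simp only [upper, Finset.mem_image, Finset.mem_filter]
  constructor
  · rintro ⟨y, ⟨h1, h2⟩, rfl⟩
    exact ⟨by omega, by rwa [show c + (y - c) = y by omega]⟩
  · rintro ⟨h1, h2⟩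
    exact ⟨c + b, ⟨h2, by omega⟩, by omega⟩

theorem eq_of_lower_upper {c : ℕ} {S T : Finset ℕ} (hl : lower c S = lower c T)
    (hu : upper c S = upper c T) (hc : c ∈ S ↔ c ∈ T) : S = T := by
  ext x
  rcases lt_trichotomy x c with h | rfl | h
  · have := Finset.ext_iff.1 hl (c - x)
    rw [mem_lower, mem_lower, show c - (c - x) = x by omega] at this
    have h1 : 1 ≤ c - x ∧ c - x ≤ c := by omega
    tauto
  · exact hc
  · have := Finset.ext_iff.1 hu (x - c)
    rw [mem_upper, mem_upper, show c + (x - c) = x by omega] at this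
    have h1 : 1 ≤ x - c := by omega
    tauto

/-- Both sides sum `w` over `S` together with the numbers below `c` that are missing from `S`. -/
theorem sum_add_sum_lower (w : ℕ → ℕ) (c : ℕ) (S : Finset ℕ) :
    ∑ x ∈ S, w x + ∑ a ∈ lower c S, w (c - a) =
      ∑ x ∈ Finset.range c, w x + (if c ∈ S then w c else 0) + ∑ b ∈ upper c S, w (c + b) := by
  have h1 : ∑ a ∈ lower c S, w (c - a) = ∑ x ∈ (Finset.range c).filter (· ∉ S), w x := by
    refine Finset.sum_bij' (fun a _ => c - a) (fun x _ => c - x) ?_ ?_ ?_ ?_ ?_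
    · intro a ha
      rw [mem_lower] at ha
      rw [Finset.mem_filter, Finset.mem_range]
      exact ⟨by omega, ha.2⟩
    · intro x hx
      rw [Finset.mem_filter, Finset.mem_range] at hx
      rw [mem_lower, show c - (c - x) = x by omega]
      exact ⟨by omega, hx.2⟩
    · intro a ha
      rw [mem_lower] at ha
      omega
    · intro x hx
      rw [Finset.mem_filter, Finset.mem_range] at hx
      omega
    · intro a _
      rfl
  have h2 : ∑ b ∈ upper c S, w (c + b) = ∑ x ∈ S.filter (c < ·), w x := by
    refine Finset.sum_bij' (fun b _ => c + b) (fun x _ => x - c) ?_ ?_ ?_ ?_ ?_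
    · intro b hb
      rw [mem_upper] at hb
      rw [Finset.mem_filter]
      exact ⟨hb.2, by omega⟩
    · intro x hx
      rw [Finset.mem_filter] at hx
      rw [mem_upper, show c + (x - c) = x by omega]
      exact ⟨by omega, hx.1⟩
    · intro b _
      omega
    · intro x hx
      rw [Finset.mem_filter] at hx
      omega
    · intro b _
      rfl
  have h3 : ∑ x ∈ S, w x = ∑ x ∈ (Finset.range c).filter (· ∈ S), w x +
      (if c ∈ S then w c else 0) + ∑ x ∈ S.filter (c < ·), w x := by
    rw [← Finset.sum_filter_add_sum_filter_not S (c < ·), add_comm]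
    congr 1
    have h4 : S.filter (fun x => ¬ c < x) = (Finset.range (c + 1)).filter (· ∈ S) := by
      ext x
      simp only [Finset.mem_filter, Finset.mem_range]
      rw [not_lt, Nat.lt_succ_iff, and_comm]
    rw [h4, Finset.sum_filter, Finset.sum_range_succ, ← Finset.sum_filter]
  have h5 := Finset.sum_filter_add_sum_filter_not (Finset.range c) (· ∈ S) w
  omega

theorem card_add_card_lower (c : ℕ) (S : Finset ℕ) :
    S.card + (lower c S).card = c + (if c ∈ S then 1 else 0) + (upper c S).card := by
  simpa using sum_add_sum_lower (fun _ => 1) c S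

theorem sum_id_add_sum_lower (c : ℕ) (S : Finset ℕ) :
    ∑ x ∈ S, x + c * (lower c S).card =
      ∑ x ∈ Finset.range c, x + (if c ∈ S then c else 0) + c * (upper c S).card +
        ∑ a ∈ lower c S, a + ∑ b ∈ upper c S, b := by
  have h1 := sum_add_sum_lower (fun x => x) c S
  have h2 : ∑ a ∈ lower c S, (c - a) + ∑ a ∈ lower c S, a = c * (lower c S).card := by
    rw [← Finset.sum_add_distrib, mul_comm, ← smul_eq_mul, ← Finset.sum_const]
    refine Finset.sum_congr rfl fun a ha => ?_
    rw [mem_lower] at ha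
    omega
  rw [Finset.sum_add_distrib, Finset.sum_const, smul_eq_mul, mul_comm] at h1
  omega

theorem sum_range_split (c m : ℕ) :
    ∑ x ∈ Finset.range (c + m + 1), x =
      ∑ x ∈ Finset.range c, x + c * (m + 1) + ∑ x ∈ Finset.range (m + 1), x := by
  rw [add_assoc, Finset.sum_range_add, Finset.sum_add_distrib, Finset.sum_const,
    Finset.card_range, smul_eq_mul]
  ring

/-! ### The pairs of the two families of partitions -/

/-- The pairs `(A, B)` of sets of positive integers with `|B| = |A| + m`, `max B ≤ max A + m` and total
sum `N`. They arise from the partitions with `m` in the rank-set and rank below `-m`, where `A` holds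
the gaps and `B` the beads. -/
def sourcePairs (m N : ℕ) : Set (Finset ℕ × Finset ℕ) :=
  {P | 0 ∉ P.1 ∧ 0 ∉ P.2 ∧ P.2.card = P.1.card + m ∧ (∃ a ∈ P.1, ∀ b ∈ P.2, b ≤ a + m) ∧
    ∑ a ∈ P.1, a + ∑ b ∈ P.2, b = N}

/-- The pairs `(A, B)` of sets of positive integers with `|A| = |B| + m + 1`, `max B + m + 1 ≤ max A`
and total sum `N`. They give the partitions with `m` outside the rank-set and rank at least `-m`,
where `A` holds the beads and `B` the gaps. The condition `m + 1 ≤ a` is the case of empty `B`. -/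
def targetPairs (m N : ℕ) : Set (Finset ℕ × Finset ℕ) :=
  {P | 0 ∉ P.1 ∧ 0 ∉ P.2 ∧ P.1.card = P.2.card + m + 1 ∧
    (∃ a ∈ P.1, m + 1 ≤ a ∧ ∀ b ∈ P.2, b + m + 1 ≤ a) ∧ ∑ a ∈ P.1, a + ∑ b ∈ P.2, b = N}

theorem pair_mem_sourcePairs {n c m : ℕ} {μ : n.Partition} (hc : n ≤ c)
    (h1 : (m : ℤ) ∈ rankSet μ) (h2 : rank μ < -(m : ℤ)) :
    (lower c (beads (c + m + 1) μ), upper c (beads (c + m + 1) μ)) ∈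
      sourcePairs m (n + ∑ i ∈ Finset.range (m + 1), i) := by
  rw [mem_rankSet_iff μ hc] at h1
  obtain ⟨z, hz1, hz2⟩ := (rank_lt_neg_iff μ hc).1 h2
  have hcard := card_beads (c + m + 1) μ
  have hsum := sum_beads μ (show n ≤ c + m + 1 by omega)
  set S := beads (c + m + 1) μ with hS
  have e1 := card_add_card_lower c S
  have e2 := sum_id_add_sum_lower c S
  rw [if_pos h1] at e1 e2
  have hu : (upper c S).card = (lower c S).card + m := by omega
  have hzc : z < c := by
    have hne : z ≠ c := fun h => hz1 (h ▸ h1)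
    -- `c + m + 1` distinct naturals have a maximum of at least `c + m`
    have hex : ∃ y ∈ S, c + m ≤ y := by
      by_contra! hlt
      have := Finset.card_le_card (show S ⊆ Finset.range (c + m) from fun y hy =>
        Finset.mem_range.2 (hlt y hy))
      rw [Finset.card_range] at this
      omega
    obtain ⟨y, hy, hy'⟩ := hex
    have := hz2 y hy
    omega
  refine ⟨by simp [mem_lower], by simp [mem_upper], hu, ⟨c - z, ?_, fun b hb => ?_⟩, ?_⟩
  · rw [mem_lower, show c - (c - z) = z by omega]
    exact ⟨by omega, hz1⟩
  · have := hz2 _ (mem_upper.1 hb).2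
    omega
  · have h3 := sum_range_split c m
    rw [hu, mul_add] at e2
    rw [mul_add] at h3
    dsimp only
    omega

theorem exists_partition_of_mem_targetPairs {n c m : ℕ} (hc : n ≤ c) {P : Finset ℕ × Finset ℕ}
    (hP : P ∈ targetPairs m (n + ∑ i ∈ Finset.range (m + 1), i))
    (hc' : n + ∑ i ∈ Finset.range (m + 1), i ≤ c) :
    ∃ μ : n.Partition, (m : ℤ) ∉ rankSet μ ∧ -(m : ℤ) ≤ rank μ ∧
      upper c (beads (c + m + 1) μ) = P.1 ∧ lower c (beads (c + m + 1) μ) = P.2 := by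
  obtain ⟨A, B⟩ := P
  obtain ⟨hA, hB, hcard, ⟨a, ha, ham, hab⟩, hsum⟩ := hP
  dsimp only at *
  set S : Finset ℕ := (Finset.range c).filter (fun x => c - x ∉ B) ∪ A.image (c + ·) with hS
  have mem_S : ∀ x, x ∈ S ↔ (x < c ∧ c - x ∉ B) ∨ ∃ a ∈ A, c + a = x := by
    intro x
    simp [hS]
  have hcS : c ∉ S := by
    rw [mem_S]
    rintro (h | ⟨a, ha, h⟩)
    · omega
    · obtain rfl : a = 0 := by omega
      exact hA ha
  have hBc : ∀ b ∈ B, b ≤ c := by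
    intro b hb
    have : b ≤ ∑ x ∈ B, x := Finset.single_le_sum (f := fun x => x) (fun _ _ => Nat.zero_le _) hb
    omega
  have hu : upper c S = A := by
    ext x
    rw [mem_upper, mem_S]
    constructor
    · rintro ⟨h, h' | ⟨a, ha, h'⟩⟩
      · omega
      · obtain rfl : a = x := by omega
        exact ha
    · intro hx
      exact ⟨Nat.one_le_iff_ne_zero.2 fun h => hA (h ▸ hx), Or.inr ⟨x, hx, rfl⟩⟩
  have hl : lower c S = B := by
    ext x
    rw [mem_lower, mem_S]
    constructor
    · rintro ⟨h, h'⟩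
      by_contra hx
      exact h' (Or.inl ⟨by omega, by rwa [show c - (c - x) = x by omega]⟩)
    · intro hx
      have h1 : 1 ≤ x := Nat.one_le_iff_ne_zero.2 fun h => hB (h ▸ hx)
      have h2 := hBc x hx
      refine ⟨⟨h1, h2⟩, ?_⟩
      rintro (h | ⟨a, ha, h⟩)
      · rw [show c - (c - x) = x by omega] at h
        exact h.2 hx
      · omega
  have e1 := card_add_card_lower c S
  have e2 := sum_id_add_sum_lower c S
  have h3 := sum_range_split c m
  rw [if_neg hcS, hu, hl] at e1 e2
  have hScard : S.card = c + m + 1 := by omega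
  have hSsum : ∑ x ∈ S, x = n + ∑ i ∈ Finset.range (c + m + 1), i := by
    rw [hcard, add_assoc B.card, mul_add] at e2
    omega
  obtain ⟨μ, hμ⟩ := exists_beads_eq hScard hSsum
  refine ⟨μ, ?_, ?_, by rw [hμ, hu], by rw [hμ, hl]⟩
  · rwa [mem_rankSet_iff μ hc, hμ]
  · rw [← not_lt, rank_lt_neg_iff μ hc, hμ]
    rintro ⟨z, hz1, hz2⟩
    have h4 := hz2 (c + a) ((mem_S _).2 (Or.inr ⟨a, ha, rfl⟩))
    have h5 : z < c := by omega
    have h6 : c - z ∈ B := by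
      by_contra h
      exact hz1 ((mem_S _).2 (Or.inl ⟨h5, h⟩))
    have := hab _ h6
    omega

/-! ### Exchanging the tails of two sets -/

/-- The elements of `A` up to `p`. -/
abbrev below (p : ℕ) (A : Finset ℕ) : Finset ℕ := A.filter (· ≤ p)

/-- The elements of `A` beyond `p`. -/
abbrev above (p : ℕ) (A : Finset ℕ) : Finset ℕ := A.filter (p < ·)

/-- The least `p` up to which `B` has at least `t` more elements than `A`. Where there is such a `p`,
the excess is exactly `t` there (`card_below_crossing`), since it grows by at most one at a time. -/
noncomputable def crossing (t : ℕ) (A B : Finset ℕ) : ℕ :=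
  sInf {p | (below p A).card + t ≤ (below p B).card}

/-- The elements of `A` up to `p` together with those of `B` beyond `p`. -/
def splice (p : ℕ) (A B : Finset ℕ) : Finset ℕ := below p A ∪ above p B

theorem below_splice {p q : ℕ} (A B : Finset ℕ) (h : q ≤ p) :
    below q (splice p A B) = below q A := by
  ext x
  simp only [splice, Finset.mem_filter, Finset.mem_union]
  constructor
  · rintro ⟨h1 | h1, h2⟩
    · exact ⟨h1.1, h2⟩
    · omega
  · rintro ⟨h1, h2⟩
    exact ⟨Or.inl ⟨h1, by omega⟩, h2⟩

theorem splice_splice (p : ℕ) (A B : Finset ℕ) : splice p (splice p A B) (splice p B A) = A := by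
  ext x
  simp only [splice, Finset.mem_filter, Finset.mem_union]
  rcases le_or_gt x p with h | h
  · simp [h, Nat.not_lt.2 h]
  · simp [h, Nat.not_le.2 h]

theorem sum_splice (w : ℕ → ℕ) (p : ℕ) (A B : Finset ℕ) :
    ∑ x ∈ splice p A B, w x = ∑ x ∈ below p A, w x + ∑ x ∈ above p B, w x := by
  refine Finset.sum_union (Finset.disjoint_left.2 fun x h1 h2 => ?_)
  rw [Finset.mem_filter] at h1 h2
  omega

theorem sum_below_add_sum_above (w : ℕ → ℕ) (p : ℕ) (A : Finset ℕ) :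
    ∑ x ∈ below p A, w x + ∑ x ∈ above p A, w x = ∑ x ∈ A, w x := by
  rw [← Finset.sum_filter_add_sum_filter_not A (· ≤ p)]
  simp only [not_le]

theorem card_below_crossing {t M : ℕ} {A B : Finset ℕ} (hB : 0 ∉ B)
    (hM : (below M A).card + t ≤ (below M B).card) :
    crossing t A B ≤ M ∧
      (below (crossing t A B) B).card = (below (crossing t A B) A).card + t := by
  have hne : {p | (below p A).card + t ≤ (below p B).card}.Nonempty := ⟨M, hM⟩
  refine ⟨Nat.sInf_le hM, le_antisymm ?_ (Nat.sInf_mem hne)⟩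
  rcases h : crossing t A B with _ | p
  · have : below 0 B = ∅ := by
      ext x
      simp only [Finset.mem_filter, Nat.le_zero, Finset.notMem_empty, iff_false]
      rintro ⟨h1, rfl⟩
      exact hB h1
    simp [this]
  · have h1 : ¬ (below p A).card + t ≤ (below p B).card :=
      fun hle => by
        have : crossing t A B ≤ p := Nat.sInf_le hle
        omega
    have h2 : (below p A).card ≤ (below (p + 1) A).card :=
      Finset.card_le_card fun x hx => by
        rw [Finset.mem_filter] at hx ⊢
        exact ⟨hx.1, by omega⟩
    have h3 : (below (p + 1) B).card ≤ (below p B).card + 1 := by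
      refine (Finset.card_le_card (t := insert (p + 1) (below p B)) fun x hx => ?_).trans
        (Finset.card_insert_le _ _)
      rw [Finset.mem_insert, Finset.mem_filter]
      rw [Finset.mem_filter] at hx
      rcases hx.2.eq_or_lt with h | h
      · exact Or.inl h
      · exact Or.inr ⟨hx.1, by omega⟩
    omega

/-- Exchanging the tails beyond the crossing leaves both sets unchanged up to it, hence does not move
it. -/
theorem crossing_splice {t M : ℕ} {A B : Finset ℕ}
    (hM : (below M A).card + t ≤ (below M B).card) :
    crossing t (splice (crossing t A B) A B) (splice (crossing t A B) B A) = crossing t A B := by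
  have hmem : crossing t A B ∈ {p | (below p A).card + t ≤ (below p B).card} :=
    Nat.sInf_mem ⟨M, hM⟩
  set p := crossing t A B with hp
  have hmem' : p ∈ {q | (below q (splice p A B)).card + t ≤ (below q (splice p B A)).card} := by
    rw [Set.mem_ofPred_eq, below_splice _ _ le_rfl, below_splice _ _ le_rfl]
    exact hmem
  apply le_antisymm
  · exact Nat.sInf_le hmem'
  · by_contra! hlt
    have h1 : crossing t (splice p A B) (splice p B A) ∈ _ := Nat.sInf_mem ⟨p, hmem'⟩
    rw [Set.mem_ofPred_eq, below_splice _ _ hlt.le, below_splice _ _ hlt.le] at h1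
    have := Nat.sInf_le (s := {p | (below p A).card + t ≤ (below p B).card}) h1
    exact absurd hlt (not_lt.2 this)

/-! ### Block codes of pairs -/

/-- The data left of a pair of finite sets after stripping a block of `k = t + 1` consecutive integers
from the top of the first set, possibly removing `k` from the second, and lowering the second by
`k`. -/
@[ext]
structure BlockCode where
  /-- The length of the block, less one. -/
  t : ℕ
  /-- A bound for the elements of the first set of a source pair, once the block is stripped. -/
  M : ℕ
  /-- Zero or one: the number `k` belongs to the second set of the source pair when this is `0`, and to
  that of the target pair when it is `1`. -/
  ε : ℕ
  /-- The first set without its top block. -/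
  A : Finset ℕ
  /-- The second set without `k`, lowered by `k`. -/
  B : Finset ℕ

namespace BlockCode

/-- The conditions on `x` that make `x.sourcePair` a member of `sourcePairs m N`. In the sum, the
term with `M + 1` accounts for the position of the block, and for `k` in the second set if
`x.ε = 0`. -/
def IsSource (m N : ℕ) (x : BlockCode) : Prop :=
  x.ε ≤ 1 ∧ x.A ⊆ Finset.Icc 1 x.M ∧ x.B ⊆ Finset.Icc 1 (x.M + m + x.ε) ∧
    x.B.card = x.A.card + x.t + m + x.ε ∧
    ∑ a ∈ x.A, a + ∑ b ∈ x.B, b + (x.t + 1) * (x.M + 1 + x.B.card) +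
      ∑ i ∈ Finset.range (x.t + 2), i = N

/-- The conditions on `x` that make `x.targetPair m` a member of `targetPairs m N`. -/
def IsTarget (m N : ℕ) (x : BlockCode) : Prop :=
  x.ε ≤ 1 ∧ x.A ⊆ Finset.Icc 1 (x.M + m + x.ε) ∧ x.B ⊆ Finset.Icc 1 x.M ∧
    x.A.card + x.t = x.B.card + m + x.ε ∧
    ∑ a ∈ x.A, a + ∑ b ∈ x.B, b + (x.t + 1) * (x.M + 1 + x.B.card + m + x.ε) +
      ∑ i ∈ Finset.range (x.t + 2), i = N

/-- The tail exchange, beyond the least `p` up to which `x.B` has `x.t` more elements than `x.A`. -/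
noncomputable def swapTails (x : BlockCode) : BlockCode where
  t := x.t
  M := x.M
  ε := x.ε
  A := splice (crossing x.t x.A x.B) x.A x.B
  B := splice (crossing x.t x.A x.B) x.B x.A

/-- The second set raised back by `k`. -/
def shiftB (x : BlockCode) : Finset ℕ := x.B.image (x.t + 1 + ·)

/-- Puts the integers `s + 1, …, s + k` on top of the first set, raises the second by `k`, and inserts
`k` into it if `e = 1`. -/
def assemble (s e : ℕ) (x : BlockCode) : Finset ℕ × Finset ℕ :=
  (x.A ∪ Finset.Ioc s (s + (x.t + 1)), if e = 1 then insert (x.t + 1) x.shiftB else x.shiftB)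

/-- The pair encoded by `x` before the tail exchange. -/
def sourcePair (x : BlockCode) : Finset ℕ × Finset ℕ := x.assemble (x.M + x.ε) (1 - x.ε)

/-- The pair encoded by `x` after the tail exchange. -/
def targetPair (m : ℕ) (x : BlockCode) : Finset ℕ × Finset ℕ := x.assemble (x.M + m + 1) x.ε

/-- The second set has at least `t` more elements than the first already up to `M`: its total excess is
`t + m + ε`, and at most `m + ε` of its elements lie beyond `M`. -/
theorem IsSource.exists_crossing {m N : ℕ} {x : BlockCode} (hx : x.IsSource m N) :
    (below x.M x.A).card + x.t ≤ (below x.M x.B).card := by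
  obtain ⟨-, hA, hB, hcard, -⟩ := hx
  have h1 : (below x.M x.A).card ≤ x.A.card := Finset.card_le_card (Finset.filter_subset _ _)
  have h2 : (above x.M x.B).card ≤ m + x.ε := by
    refine (Finset.card_le_card (t := Finset.Ioc x.M (x.M + m + x.ε)) fun b hb => ?_).trans ?_
    · rw [Finset.mem_filter] at hb
      have := Finset.mem_Icc.1 (hB hb.1)
      exact Finset.mem_Ioc.2 ⟨hb.2, this.2⟩
    · rw [Nat.card_Ioc]
      omega
  have h3 := sum_below_add_sum_above (fun _ => 1) x.M x.B
  simp only [← Finset.card_eq_sum_ones] at h3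
  omega

theorem IsSource.swapTails {m N : ℕ} {x : BlockCode} (hx : x.IsSource m N) :
    x.swapTails.IsTarget m N := by
  have hM := hx.exists_crossing
  obtain ⟨hε, hA, hB, hcard, hsum⟩ := hx
  have hB0 : 0 ∉ x.B := fun h => by simpa using hB h
  obtain ⟨hpM, hp⟩ := card_below_crossing hB0 hM
  have sA := sum_below_add_sum_above (fun y => y) (crossing x.t x.A x.B) x.A
  have sB := sum_below_add_sum_above (fun y => y) (crossing x.t x.A x.B) x.B
  have cA := sum_below_add_sum_above (fun _ => 1) (crossing x.t x.A x.B) x.A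
  have cB := sum_below_add_sum_above (fun _ => 1) (crossing x.t x.A x.B) x.B
  have sA' := sum_splice (fun y => y) (crossing x.t x.A x.B) x.A x.B
  have sB' := sum_splice (fun y => y) (crossing x.t x.A x.B) x.B x.A
  have cA' := sum_splice (fun _ => 1) (crossing x.t x.A x.B) x.A x.B
  have cB' := sum_splice (fun _ => 1) (crossing x.t x.A x.B) x.B x.A
  simp only [← Finset.card_eq_sum_ones] at cA cB cA' cB'
  have hBc : (splice (crossing x.t x.A x.B) x.B x.A).card + m + x.ε = x.B.card := by omega
  refine ⟨hε, fun y hy => ?_, fun y hy => ?_, ?_, ?_⟩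
  · simp only [BlockCode.swapTails, splice, Finset.mem_union, Finset.mem_filter] at hy ⊢
    rcases hy with hy | hy
    · have := Finset.mem_Icc.1 (hA hy.1)
      exact Finset.mem_Icc.2 (by omega)
    · exact hB hy.1
  · simp only [BlockCode.swapTails, splice, Finset.mem_union, Finset.mem_filter] at hy ⊢
    rcases hy with hy | hy
    · have := Finset.mem_Icc.1 (hB hy.1)
      exact Finset.mem_Icc.2 (by omega)
    · exact hA hy.1
  · simp only [BlockCode.swapTails]
    omega
  · simp only [BlockCode.swapTails]
    rw [show x.M + 1 + (splice (crossing x.t x.A x.B) x.B x.A).card + m + x.ε =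
      x.M + 1 + x.B.card by omega]
    omega

theorem IsSource.swapTails_swapTails {m N : ℕ} {x : BlockCode} (hx : x.IsSource m N) :
    x.swapTails.swapTails = x := by
  have h := crossing_splice hx.exists_crossing
  ext1
  · rfl
  · rfl
  · rfl
  · simp only [BlockCode.swapTails]
    rw [h, splice_splice]
  · simp only [BlockCode.swapTails]
    rw [h, splice_splice]

theorem sum_Ioc_add (a k : ℕ) :
    ∑ i ∈ Finset.Ioc a (a + k), i = k * a + ∑ i ∈ Finset.range (k + 1), i := by
  induction k with
  | zero => simp
  | succ k ih =>
    rw [← add_assoc a, Finset.sum_Ioc_succ_top (by omega), ih, Finset.sum_range_succ _ (k + 1)]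
    ring

theorem card_shiftB (x : BlockCode) : x.shiftB.card = x.B.card :=
  Finset.card_image_of_injective _ fun _ _ h => Nat.add_left_cancel h

theorem sum_shiftB (x : BlockCode) :
    ∑ b ∈ x.shiftB, b = (x.t + 1) * x.B.card + ∑ b ∈ x.B, b := by
  rw [shiftB, Finset.sum_image fun _ _ _ _ h => Nat.add_left_cancel h, Finset.sum_add_distrib,
    Finset.sum_const, smul_eq_mul, mul_comm]

theorem mem_shiftB {x : BlockCode} {y : ℕ} : y ∈ x.shiftB ↔ ∃ b ∈ x.B, x.t + 1 + b = y := by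
  simp [shiftB]

theorem notMem_shiftB {x : BlockCode} (h : 0 ∉ x.B) : x.t + 1 ∉ x.shiftB := by
  rw [mem_shiftB]
  rintro ⟨b, hb, hb'⟩
  obtain rfl : b = 0 := by omega
  exact h hb

theorem mem_assemble_fst {s e a : ℕ} {x : BlockCode} :
    a ∈ (x.assemble s e).1 ↔ a ∈ x.A ∨ (s < a ∧ a ≤ s + (x.t + 1)) := by
  simp [assemble]

theorem mem_assemble_snd {s e b : ℕ} {x : BlockCode} :
    b ∈ (x.assemble s e).2 ↔ (e = 1 ∧ b = x.t + 1) ∨ b ∈ x.shiftB := by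
  simp only [assemble]
  split_ifs with h <;> simp [h]

theorem card_assemble_fst {s : ℕ} (e : ℕ) {x : BlockCode} (hA : ∀ a ∈ x.A, a ≤ s) :
    (x.assemble s e).1.card = x.A.card + (x.t + 1) := by
  have hd : Disjoint x.A (Finset.Ioc s (s + (x.t + 1))) :=
    Finset.disjoint_left.2 fun y h1 h2 => (Finset.mem_Ioc.1 h2).1.not_ge (hA y h1)
  rw [assemble, Finset.card_union_of_disjoint hd, Nat.card_Ioc]
  omega

theorem sum_assemble_fst {s : ℕ} (e : ℕ) {x : BlockCode} (hA : ∀ a ∈ x.A, a ≤ s) :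
    ∑ a ∈ (x.assemble s e).1, a =
      ∑ a ∈ x.A, a + ((x.t + 1) * s + ∑ i ∈ Finset.range (x.t + 2), i) := by
  have hd : Disjoint x.A (Finset.Ioc s (s + (x.t + 1))) :=
    Finset.disjoint_left.2 fun y h1 h2 => (Finset.mem_Ioc.1 h2).1.not_ge (hA y h1)
  rw [assemble, Finset.sum_union hd, sum_Ioc_add]

theorem card_assemble_snd (s : ℕ) {e : ℕ} (he : e ≤ 1) {x : BlockCode} (hB : 0 ∉ x.B) :
    (x.assemble s e).2.card = x.B.card + e := by
  rw [assemble]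
  split_ifs with h
  · rw [Finset.card_insert_of_notMem (notMem_shiftB hB), card_shiftB, h]
  · rw [card_shiftB]
    omega

theorem sum_assemble_snd (s : ℕ) {e : ℕ} (he : e ≤ 1) {x : BlockCode} (hB : 0 ∉ x.B) :
    ∑ b ∈ (x.assemble s e).2, b = ∑ b ∈ x.B, b + (x.t + 1) * (x.B.card + e) := by
  rw [assemble]
  split_ifs with h
  · rw [Finset.sum_insert (notMem_shiftB hB), sum_shiftB, h]
    ring
  · rw [sum_shiftB, show e = 0 by omega]
    ring

theorem IsTarget.targetPair_mem {m N : ℕ} {x : BlockCode} (hx : x.IsTarget m N) :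
    x.targetPair m ∈ targetPairs m N := by
  obtain ⟨hε, hA, hB, hcard, hsum⟩ := hx
  have hB0 : 0 ∉ x.B := fun h => by simpa using hB h
  have hA' : ∀ a ∈ x.A, a ≤ x.M + m + 1 := fun a ha => by
    have := Finset.mem_Icc.1 (hA ha)
    omega
  have cA := card_assemble_fst x.ε hA'
  have cB := card_assemble_snd (x.M + m + 1) hε hB0
  have hmem : ∀ b ∈ (x.targetPair m).2, x.t + 1 ≤ b ∧ b ≤ x.M + x.t + 1 := by
    intro b hb
    rcases mem_assemble_snd.1 hb with h | h
    · omega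
    · obtain ⟨b', hb', rfl⟩ := mem_shiftB.1 h
      have := Finset.mem_Icc.1 (hB hb')
      omega
  refine ⟨fun h => ?_, fun h => ?_, ?_, ⟨x.M + m + 1 + (x.t + 1), ?_, by omega, ?_⟩, ?_⟩
  · rcases mem_assemble_fst.1 h with h | h
    · simpa using hA h
    · omega
  · have := hmem 0 h
    omega
  · rw [targetPair]
    omega
  · exact mem_assemble_fst.2 (by omega)
  · intro b hb
    have := hmem b hb
    omega
  · rw [targetPair, sum_assemble_fst _ hA', sum_assemble_snd _ hε hB0, ← hsum]
    ring

/-- The code of `(A, B)` comes from the least `k = t + 1` with `k ∈ B` or `max A - k ∉ A`; the case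
`k ∈ B` is `ε = 0`. -/
theorem exists_sourcePair_eq {m N : ℕ} {P : Finset ℕ × Finset ℕ} (hP : P ∈ sourcePairs m N) :
    ∃ x : BlockCode, x.IsSource m N ∧ x.sourcePair = P := by
  obtain ⟨A, B⟩ := P
  obtain ⟨hA0, hB0, hcard, ⟨a, ha, hab⟩, hsum⟩ := hP
  dsimp only at hA0 hB0 hcard ha hab hsum
  -- it suffices to find the parameters; the numerical conditions then follow
  suffices h : ∃ x : BlockCode, x.ε ≤ 1 ∧ x.A ⊆ Finset.Icc 1 x.M ∧
      x.B ⊆ Finset.Icc 1 (x.M + m + x.ε) ∧ x.sourcePair = (A, B) by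
    obtain ⟨x, hε, hA, hB, hx⟩ := h
    have hB0 : 0 ∉ x.B := fun h => by simpa using hB h
    have hA' : ∀ a ∈ x.A, a ≤ x.M + x.ε := fun a ha => by
      have := Finset.mem_Icc.1 (hA ha)
      omega
    have cA := card_assemble_fst (1 - x.ε) hA'
    have cB := card_assemble_snd (x.M + x.ε) (show 1 - x.ε ≤ 1 by omega) hB0
    have sA := sum_assemble_fst (1 - x.ε) hA'
    have sB := sum_assemble_snd (x.M + x.ε) (show 1 - x.ε ≤ 1 by omega) hB0
    rw [← sourcePair, hx] at cA cB sA sB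
    dsimp only at cA cB sA sB
    refine ⟨x, ⟨hε, hA, hB, by omega, ?_⟩, hx⟩
    have h1 : (x.t + 1) * (x.M + 1 + x.B.card) =
        (x.t + 1) * (x.M + x.ε) + (x.t + 1) * (x.B.card + (1 - x.ε)) := by
      rw [← mul_add]
      congr 1
      omega
    omega
  set T := A.max' ⟨a, ha⟩ with hT
  have hTA : T ∈ A := Finset.max'_mem _ _
  have hAT : ∀ y ∈ A, y ≤ T := fun y hy => Finset.le_max' _ _ hy
  have hBT : ∀ b ∈ B, b ≤ T + m := fun b hb => (hab b hb).trans (by have := hAT a ha; omega)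
  have hex : ∃ t, t + 1 ∈ B ∨ T - (t + 1) ∉ A := ⟨T, Or.inr (by simpa using hA0)⟩
  obtain ⟨t, ht, hmin⟩ : ∃ t, (t + 1 ∈ B ∨ T - (t + 1) ∉ A) ∧
      ∀ i < t, i + 1 ∉ B ∧ T - (i + 1) ∈ A := by
    refine ⟨Nat.find hex, Nat.find_spec hex, fun i hi => ?_⟩
    have := Nat.find_min hex hi
    tauto
  have hblock : ∀ i ≤ t, T - i ∈ A := by
    intro i hi
    rcases i with _ | i
    · exact hTA
    · exact (hmin i (by omega)).2
  have hTt : t + 1 ≤ T := by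
    by_contra! h
    have := hblock t le_rfl
    rw [show T - t = 0 by omega] at this
    exact hA0 this
  have hBt : ∀ b ∈ B, t + 1 ≤ b := by
    intro b hb
    by_contra! h
    rcases b with _ | b
    · exact hB0 hb
    · exact (hmin b (by omega)).1 hb
  have hA1 : ∀ y ∈ A, 1 ≤ y := fun y hy => Nat.one_le_iff_ne_zero.2 fun h => hA0 (h ▸ hy)
  by_cases htB : t + 1 ∈ B
  · refine ⟨⟨t, T - (t + 1), 0, below (T - (t + 1)) A, (B.erase (t + 1)).image (· - (t + 1))⟩,
      Nat.zero_le _, ?_, ?_, ?_⟩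
    · intro y hy
      rw [Finset.mem_filter] at hy
      exact Finset.mem_Icc.2 ⟨hA1 y hy.1, hy.2⟩
    · intro y hy
      obtain ⟨b, hb, rfl⟩ := Finset.mem_image.1 hy
      rw [Finset.mem_erase] at hb
      have h1 := hBt b hb.2
      have h2 := hBT b hb.2
      exact Finset.mem_Icc.2 (by dsimp only; omega)
    · refine Prod.ext (Finset.ext fun y => ?_) (Finset.ext fun y => ?_)
      · rw [sourcePair, mem_assemble_fst]
        simp only [Finset.mem_filter]
        constructor
        · rintro (h | h)
          · exact h.1
          · have := hblock (T - y) (by omega)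
            rwa [show T - (T - y) = y by omega] at this
        · intro h
          have := hAT y h
          by_cases hy : y ≤ T - (t + 1)
          · exact Or.inl ⟨h, hy⟩
          · exact Or.inr (by omega)
      · rw [sourcePair, mem_assemble_snd, mem_shiftB]
        simp only [Finset.mem_image, Finset.mem_erase]
        constructor
        · rintro (h | ⟨b, ⟨b', hb', rfl⟩, rfl⟩)
          · rwa [h.2]
          · have := hBt b' hb'.2
            rw [show t + 1 + (b' - (t + 1)) = b' by omega]
            exact hb'.2
        · intro h
          by_cases hy : y = t + 1
          · exact Or.inl ⟨trivial, hy⟩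
          · have := hBt y h
            exact Or.inr ⟨y - (t + 1), ⟨y, ⟨hy, h⟩, rfl⟩, by omega⟩
  · have htA : T - (t + 1) ∉ A := by tauto
    have hBt' : ∀ b ∈ B, t + 2 ≤ b := by
      intro b hb
      have := hBt b hb
      have : b ≠ t + 1 := fun h => htB (h ▸ hb)
      omega
    -- otherwise `A` is nonempty and `B` has at most `m` elements
    have hTt' : t + 2 ≤ T := by
      by_contra! h
      have h1 : B.card ≤ m := by
        refine (Finset.card_le_card (t := Finset.Ioc T (T + m)) fun b hb => ?_).trans ?_
        · have := hBt' b hb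
          exact Finset.mem_Ioc.2 ⟨by omega, hBT b hb⟩
        · rw [Nat.card_Ioc]
          omega
      have := Finset.card_pos.2 ⟨T, hTA⟩
      omega
    refine ⟨⟨t, T - (t + 2), 1, below (T - (t + 2)) A, B.image (· - (t + 1))⟩,
      le_rfl, ?_, ?_, ?_⟩
    · intro y hy
      rw [Finset.mem_filter] at hy
      exact Finset.mem_Icc.2 ⟨hA1 y hy.1, hy.2⟩
    · intro y hy
      obtain ⟨b, hb, rfl⟩ := Finset.mem_image.1 hy
      have h1 := hBt' b hb
      have h2 := hBT b hb
      exact Finset.mem_Icc.2 (by dsimp only; omega)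
    · refine Prod.ext (Finset.ext fun y => ?_) (Finset.ext fun y => ?_)
      · rw [sourcePair, mem_assemble_fst]
        simp only [Finset.mem_filter]
        constructor
        · rintro (h | h)
          · exact h.1
          · have := hblock (T - y) (by omega)
            rwa [show T - (T - y) = y by omega] at this
        · intro h
          have := hAT y h
          have hy' : y ≠ T - (t + 1) := fun h' => htA (h' ▸ h)
          by_cases hy : y ≤ T - (t + 2)
          · exact Or.inl ⟨h, hy⟩
          · exact Or.inr (by omega)
      · rw [sourcePair, mem_assemble_snd, mem_shiftB]
        simp only [Finset.mem_image]
        constructor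
        · rintro (h | ⟨b, ⟨b', hb', rfl⟩, rfl⟩)
          · omega
          · have := hBt b' hb'
            rw [show t + 1 + (b' - (t + 1)) = b' by omega]
            exact hb'
        · intro h
          have := hBt y h
          exact Or.inr ⟨y - (t + 1), ⟨y, h, rfl⟩, by omega⟩

/-- For a target pair `(A, B)`, the number `k` is again the least with `k ∈ B` or `max A - k ∉ A`, and
`ε = 1` means that `k ∈ B`. -/
theorem targetPair_injOn (m N : ℕ) : Set.InjOn (targetPair m) {x | x.IsTarget m N} := by
  -- the parameters of a code are read off from the pair
  have facts : ∀ x : BlockCode, x.IsTarget m N →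
      (x.M + m + 1 + (x.t + 1) ∈ (x.targetPair m).1 ∧
        ∀ a ∈ (x.targetPair m).1, a ≤ x.M + m + 1 + (x.t + 1)) ∧
      (∀ i, x.M + m + 1 < i → i ≤ x.M + m + 1 + (x.t + 1) → i ∈ (x.targetPair m).1) ∧
      (∀ b ∈ (x.targetPair m).2, x.t + 1 ≤ b) ∧
      (x.t + 1 ∈ (x.targetPair m).2 ↔ x.ε = 1) ∧
      (x.ε = 0 → x.M + m + 1 ∉ (x.targetPair m).1) ∧
      below (x.M + m + x.ε) (x.targetPair m).1 = x.A ∧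
      (∀ b, b ∈ x.B ↔ 1 ≤ b ∧ x.t + 1 + b ∈ (x.targetPair m).2) := by
    rintro x ⟨hε, hA, hB, -, -⟩
    have hB0 : 0 ∉ x.B := fun h => by simpa using hB h
    have hA' : ∀ a ∈ x.A, 1 ≤ a ∧ a ≤ x.M + m + x.ε := fun a ha => Finset.mem_Icc.1 (hA ha)
    have hk := notMem_shiftB hB0
    have m1 : ∀ a, a ∈ (x.targetPair m).1 ↔
        a ∈ x.A ∨ (x.M + m + 1 < a ∧ a ≤ x.M + m + 1 + (x.t + 1)) := fun a => mem_assemble_fst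
    have m2 : ∀ b, b ∈ (x.targetPair m).2 ↔ (x.ε = 1 ∧ b = x.t + 1) ∨ b ∈ x.shiftB :=
      fun b => mem_assemble_snd
    refine ⟨⟨?_, ?_⟩, ?_, ?_, ?_, ?_, ?_, ?_⟩
    · rw [m1]
      omega
    · intro a ha
      rcases (m1 a).1 ha with h | h
      · have := hA' a h
        omega
      · exact h.2
    · intro i h1 h2
      rw [m1]
      exact Or.inr ⟨h1, h2⟩
    · intro b hb
      rcases (m2 b).1 hb with h | h
      · omega
      · obtain ⟨b, -, rfl⟩ := mem_shiftB.1 h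
        omega
    · rw [m2]
      simp [hk]
    · intro h0 h
      rcases (m1 _).1 h with h | h
      · have := hA' _ h
        omega
      · omega
    · ext a
      rw [Finset.mem_filter, m1]
      constructor
      · rintro ⟨h | h, h'⟩
        · exact h
        · omega
      · intro h
        exact ⟨Or.inl h, (hA' a h).2⟩
    · intro b
      rw [m2, mem_shiftB]
      constructor
      · intro h
        exact ⟨Nat.one_le_iff_ne_zero.2 fun h' => hB0 (h' ▸ h), Or.inr ⟨b, h, rfl⟩⟩
      · rintro ⟨h1, h | ⟨b', hb', h⟩⟩
        · omega
        · obtain rfl : b' = b := by omega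
          exact hb'
  have not_lt_t : ∀ x y : BlockCode, x.IsTarget m N → y.IsTarget m N →
      x.targetPair m = y.targetPair m → ¬ x.t < y.t := by
    intro x y hx hy hxy hlt
    have hxε := hx.1
    obtain ⟨⟨hx1, hx2⟩, -, -, hx4, hx5, -, -⟩ := facts x hx
    obtain ⟨⟨hy1, hy2⟩, hy3, hy4, -, -, -, -⟩ := facts y hy
    rw [hxy] at hx1 hx2 hx4 hx5
    have htop := le_antisymm (hy2 _ hx1) (hx2 _ hy1)
    by_cases h : x.ε = 1
    · have := hy4 _ (hx4.2 h)
      omega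
    · exact hx5 (by omega) (hy3 _ (by omega) (by omega))
  intro x hx y hy hxy
  have ht : x.t = y.t :=
    le_antisymm (not_lt.1 (not_lt_t y x hy hx hxy.symm)) (not_lt.1 (not_lt_t x y hx hy hxy))
  have hxε := hx.1
  have hyε := hy.1
  obtain ⟨⟨hx1, hx2⟩, -, -, hx4, -, hx6, hx7⟩ := facts x hx
  obtain ⟨⟨hy1, hy2⟩, -, -, hy4, -, hy6, hy7⟩ := facts y hy
  rw [hxy] at hx1 hx2 hx4 hx6 hx7
  have hM : x.M = y.M := by
    have := le_antisymm (hy2 _ hx1) (hx2 _ hy1)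
    omega
  have hε : x.ε = y.ε := by
    rw [ht, hy4] at hx4
    omega
  refine BlockCode.ext ht hM hε ?_ ?_
  · rw [← hx6, ← hy6, hM, hε]
  · ext b
    rw [hx7, hy7, ht]

end BlockCode

/-! ### The injection -/

theorem exists_injOn_sourcePairs (m N : ℕ) :
    ∃ F : Finset ℕ × Finset ℕ → Finset ℕ × Finset ℕ,
      Set.MapsTo F (sourcePairs m N) (targetPairs m N) ∧ Set.InjOn F (sourcePairs m N) := by
  have : Nonempty BlockCode := ⟨⟨0, 0, 0, ∅, ∅⟩⟩
  choose! code hcode using fun P (hP : P ∈ sourcePairs m N) => BlockCode.exists_sourcePair_eq hP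
  refine ⟨fun P => (code P).swapTails.targetPair m,
    fun P hP => (hcode P hP).1.swapTails.targetPair_mem, fun P hP Q hQ hPQ => ?_⟩
  have h1 := BlockCode.targetPair_injOn m N (hcode P hP).1.swapTails (hcode Q hQ).1.swapTails hPQ
  have h2 : code P = code Q := by
    rw [← (hcode P hP).1.swapTails_swapTails, h1, (hcode Q hQ).1.swapTails_swapTails]
  rw [← (hcode P hP).2, h2, (hcode Q hQ).2]

theorem ncard_rankSet_diff_le (m n : ℕ) :
    ({μ : n.Partition | (m : ℤ) ∈ rankSet μ} \ {μ | -(m : ℤ) ≤ rank μ}).ncard ≤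
      ({μ : n.Partition | -(m : ℤ) ≤ rank μ} \ {μ | (m : ℤ) ∈ rankSet μ}).ncard := by
  set N := n + ∑ i ∈ Finset.range (m + 1), i with hN
  have hc : n ≤ N := Nat.le_add_right _ _
  obtain ⟨F, hF, hFinj⟩ := exists_injOn_sourcePairs m N
  let pair : n.Partition → Finset ℕ × Finset ℕ := fun μ =>
    (lower N (beads (N + m + 1) μ), upper N (beads (N + m + 1) μ))
  have hpair : ∀ μ ∈ {μ : n.Partition | (m : ℤ) ∈ rankSet μ} \ {μ | -(m : ℤ) ≤ rank μ},
      pair μ ∈ sourcePairs m N := fun μ hμ => pair_mem_sourcePairs hc hμ.1 (not_le.1 hμ.2)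
  choose! G hG using fun P (hP : P ∈ targetPairs m N) =>
    exists_partition_of_mem_targetPairs hc hP le_rfl
  refine Set.ncard_le_ncard_of_injOn (fun μ => G (F (pair μ))) (fun μ hμ => ?_)
    (fun μ hμ ν hν h => ?_) (Set.toFinite _)
  · have := hG _ (hF (hpair μ hμ))
    exact ⟨this.2.1, this.1⟩
  · have hGμ := hG _ (hF (hpair μ hμ))
    have hGν := hG _ (hF (hpair ν hν))
    dsimp only at h
    have h1 : F (pair μ) = F (pair ν) := by
      refine Prod.ext ?_ ?_
      · rw [← hGμ.2.2.1, h, hGν.2.2.1]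
      · rw [← hGμ.2.2.2, h, hGν.2.2.2]
    have h2 := Prod.ext_iff.1 (hFinj (hpair μ hμ) (hpair ν hν) h1)
    refine beads_injective (show n ≤ N + m + 1 by omega) (eq_of_lower_upper h2.1 h2.2 ?_)
    rw [← mem_rankSet_iff μ hc, ← mem_rankSet_iff ν hc]
    exact ⟨fun _ => hν.1, fun _ => hμ.1⟩

end DysonRank


theorem theorem1p4 (m n : ℕ) (hn : 1 ≤ n) :
    DysonRank.q (m : ℤ) n ≤ DysonRank.p (-(m : ℤ)) n := by
  rw [DysonRank.q, DysonRank.p,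
    ← Set.ncard_inter_add_ncard_sdiff_eq_ncard {μ : n.Partition | (m : ℤ) ∈ DysonRank.rankSet μ}
      {μ | -(m : ℤ) ≤ DysonRank.rank μ},
    ← Set.ncard_inter_add_ncard_sdiff_eq_ncard {μ : n.Partition | -(m : ℤ) ≤ DysonRank.rank μ}
      {μ | (m : ℤ) ∈ DysonRank.rankSet μ}, Set.inter_comm]
  exact Nat.add_le_add_left (DysonRank.ncard_rankSet_diff_le m n) _
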